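/- Let $K$ be a field of characteristic zero (for instance $K=\mathbf{C}$), let $V$ be a finite-dimensional vector space over $K$, let $\lambda$ be a partition of a positive integer $n$, and let $\chi^\lambda$ be the irreducible character of the symmetric group $\mathfrak{S}_n$ corresponding to $\lambda$ (the character of the Specht module of $\lambda$, with values in $K$). Let $\mathfrak{S}_n$ act on the right on $V^{\otimes n}$ by $(v_1\otimes\dots\otimes v_n)\sigma = v_{\sigma(1)}\otimes\dots\otimes v_{\sigma(n)}$, extend this linearly to a right action of the group algebra $K\mathfrak{S}_n$, and let $T_\lambda$ be the endomorphism of $V^{\otimes n}$ given by \[ (v_1\otimes\dots\otimes v_n)T_\lambda=\frac{\chi^\lambda(1)}{n!}\sum_{\sigma\in\mathfrak{S}_n}\chi^\lambda(\sigma)\,v_{\sigma(1)}\otimes\dots\otimes v_{\sigma(n)}. \] A tableau $T$ of shape $\lambda$ is a filling of the boxes of the Young diagram of $\lambda$ with the numbers $1,\dots,n$, each used exactly once. Let $\operatorname{Row}(T)$ and $\operatorname{Col}(T)$ be the subgroups of $\mathfrak{S}_n$ that stabilize each row, respectively each column, of $T$, and put \[ a_T=\sum_{\sigma\in\operatorname{Row}(T)}\sigma,\qquad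 b_T=\sum_{\sigma\in\operatorname{Col}(T)}\operatorname{sign}(\sigma)\,\sigma,\qquad c_T=b_Ta_T\in K\mathfrak{S}_n . \] For $v_1,\dots,v_n,u_1,\dots,u_n\in V$ write $v^\otimes=v_1\otimes\dots\otimes v_n$ and $u^\otimes=u_1\otimes\dots\otimes u_n$. Then $v^\otimes T_\lambda=u^\otimes T_\lambda$ if and only if $v^\otimes c_T=u^\otimes c_T$ for every tableau $T$ of shape $\lambda$. -/

import Mathlib

open scoped TensorProduct

namespace YoungSymm

open Equiv

/-- The Young diagram of a partition `lam` of `n`: the box `(i, j)` belongs to it when `j` is less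
than the `i`-th largest part (rows and columns are numbered from `0`). -/
def diagram {n : ℕ} (lam : n.Partition) : YoungDiagram :=
  YoungDiagram.ofRowLens (lam.parts.sort (fun a b => b ≤ a))
    (Multiset.pairwise_sort lam.parts (fun a b => b ≤ a)).sortedGE

/-- A tableau of shape `lam`: a filling of the boxes of the diagram of `lam` with the numbers
of `Fin n`, each number being used exactly once. -/
@[ext]
structure Tableau {n : ℕ} (lam : n.Partition) where
  /-- the number that is written in a given box -/
  entry : {c : ℕ × ℕ // c ∈ (diagram lam).cells} ≃ Fin n

section

variable {n : ℕ} {lam : n.Partition}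

namespace Tableau

/-- The row of `T` in which the number `i` is written. -/
def rowOf (T : Tableau lam) (i : Fin n) : ℕ := (T.entry.symm i).1.1

/-- The column of `T` in which the number `i` is written. -/
def colOf (T : Tableau lam) (i : Fin n) : ℕ := (T.entry.symm i).1.2

/-- The row group of `T`: the permutations that stabilize each row of `T`. -/
def rowGroup (T : Tableau lam) : Subgroup (Perm (Fin n)) where
  carrier := {σ | ∀ i, T.rowOf (σ i) = T.rowOf i}
  mul_mem' hσ hτ i := (hσ _).trans (hτ i)
  one_mem' _ := rfl
  inv_mem' {σ} hσ i := by simpa using (hσ (σ⁻¹ i)).symm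

/-- The column group of `T`: the permutations that stabilize each column of `T`. -/
def colGroup (T : Tableau lam) : Subgroup (Perm (Fin n)) where
  carrier := {σ | ∀ i, T.colOf (σ i) = T.colOf i}
  mul_mem' hσ hτ i := (hσ _).trans (hτ i)
  one_mem' _ := rfl
  inv_mem' {σ} hσ i := by simpa using (hσ (σ⁻¹ i)).symm

end Tableau

open Classical in
/-- The row symmetrizer `a_T`, the sum of the elements of the row group. -/
noncomputable def rowSymm (K : Type*) [Field K] (T : Tableau lam) :
    MonoidAlgebra K (Perm (Fin n)) :=
  ∑ σ : Perm (Fin n) with σ ∈ T.rowGroup, MonoidAlgebra.single σ (1 : K)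

open Classical in
/-- The column antisymmetrizer `b_T`, the signed sum of the elements of the column group. -/
noncomputable def colAntisymm (K : Type*) [Field K] (T : Tableau lam) :
    MonoidAlgebra K (Perm (Fin n)) :=
  ∑ σ : Perm (Fin n) with σ ∈ T.colGroup, MonoidAlgebra.single σ ((Perm.sign σ : ℤ) : K)

/-- The Young symmetrizer `c_T = b_T a_T`. -/
noncomputable def youngSymm (K : Type*) [Field K] (T : Tableau lam) :
    MonoidAlgebra K (Perm (Fin n)) :=
  colAntisymm K T * rowSymm K T

/-! ### The irreducible character of a partition, as the character of the Specht module -/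

/-- A permutation acts on a tableau by replacing each entry `i` by `σ i`. -/
instance : MulAction (Perm (Fin n)) (Tableau lam) where
  smul σ T := ⟨T.entry.trans σ⟩
  one_smul _ := rfl
  mul_smul _ _ _ := rfl

theorem rowOf_smul (σ : Perm (Fin n)) (T : Tableau lam) (i : Fin n) :
    (σ • T).rowOf i = T.rowOf (σ⁻¹ i) := rfl

theorem colOf_smul (σ : Perm (Fin n)) (T : Tableau lam) (i : Fin n) :
    (σ • T).colOf i = T.colOf (σ⁻¹ i) := rfl

/-- Two tableaux are row equivalent when they have the same set of entries in each row. -/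
instance rowSetoid (lam : n.Partition) : Setoid (Tableau lam) where
  r T S := ∀ i, T.rowOf i = S.rowOf i
  iseqv := ⟨fun _ _ => rfl, fun h i => (h i).symm, fun h h' i => (h i).trans (h' i)⟩

/-- A tabloid of shape `lam`: a row equivalence class of tableaux. -/
def Tabloid (lam : n.Partition) : Type := Quotient (rowSetoid lam)

/-- The tabloid of a tableau. -/
def Tableau.tabloid (T : Tableau lam) : Tabloid lam := Quotient.mk (rowSetoid lam) T

instance : MulAction (Perm (Fin n)) (Tabloid lam) where
  smul σ := Quotient.map (σ • ·) fun _ _ h i => h (σ⁻¹ i)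
  one_smul t := Quotient.inductionOn t fun _ => rfl
  mul_smul _ _ t := Quotient.inductionOn t fun _ => rfl

theorem smul_tabloid (σ : Perm (Fin n)) (T : Tableau lam) :
    σ • T.tabloid = (σ • T).tabloid := rfl

/-- The permutation representation of the symmetric group on the vector space with basis the
tabloids of shape `lam`. -/
noncomputable def tabloidRep (K : Type*) [Field K] (lam : n.Partition) :
    Representation K (Perm (Fin n)) (MonoidAlgebra K (Tabloid lam)) :=
  Representation.ofMulAction K (Perm (Fin n)) (Tabloid lam)

/-- The polytabloid of `T`: the column antisymmetrizer of `T` applied to the tabloid of `T`. -/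
noncomputable def polytabloid (K : Type*) [Field K] (T : Tableau lam) :
    MonoidAlgebra K (Tabloid lam) :=
  (tabloidRep K lam).asAlgebraHom (colAntisymm K T) (MonoidAlgebra.single T.tabloid 1)

theorem tabloidRep_single (K : Type*) [Field K] (σ : Perm (Fin n)) (t : Tabloid lam) (a : K) :
    tabloidRep K lam σ (MonoidAlgebra.single t a) = MonoidAlgebra.single (σ • t) a := by
  simp [tabloidRep]

theorem single_mul_colAntisymm (K : Type*) [Field K] (σ : Perm (Fin n)) (T : Tableau lam) :
    MonoidAlgebra.single σ 1 * colAntisymm K T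
      = colAntisymm K (σ • T) * MonoidAlgebra.single σ 1 := by
  classical
  simp only [colAntisymm, Finset.mul_sum, Finset.sum_mul, MonoidAlgebra.single_mul_single]
  refine Finset.sum_equiv (MulAut.conj σ).toEquiv (fun τ => ?_) (fun τ _ => ?_)
  · simp only [Finset.mem_filter, Finset.mem_univ, true_and]
    constructor
    · intro h i
      simpa [colOf_smul] using h (σ⁻¹ i)
    · intro h i
      simpa [colOf_smul] using h (σ i)
  · rcases Int.units_eq_one_or (Perm.sign σ) with h | h <;> simp [h]

theorem tabloidRep_polytabloid (K : Type*) [Field K] (σ : Perm (Fin n)) (T : Tableau lam) :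
    tabloidRep K lam σ (polytabloid K T) = polytabloid K (σ • T) := by
  have h := congrArg (fun x => (tabloidRep K lam).asAlgebraHom x
    (MonoidAlgebra.single T.tabloid 1)) (single_mul_colAntisymm K σ T)
  simpa [polytabloid, tabloidRep_single, smul_tabloid] using h

/-- The Specht module of `lam`: the span of the polytabloids, as a subrepresentation of the
tabloid representation. -/
noncomputable def specht (K : Type*) [Field K] (lam : n.Partition) :
    Subrepresentation (tabloidRep K lam) where
  toSubmodule := Submodule.span K (Set.range (polytabloid K (lam := lam)))
  apply_mem_toSubmodule σ := by
    change Submodule.span K _ ≤ (Submodule.span K _).comap (tabloidRep K lam σ)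
    rw [Submodule.span_le]
    rintro _ ⟨T, rfl⟩
    exact Submodule.subset_span ⟨σ • T, (tabloidRep_polytabloid K σ T).symm⟩

/-- The irreducible character `χ^lam` of the symmetric group. -/
noncomputable def irrChar (K : Type*) [Field K] (lam : n.Partition) (σ : Perm (Fin n)) : K :=
  (specht K lam).toRepresentation.character σ

end

/-! ### The right action of the symmetric group on tensors -/

section

variable (K V : Type*) [Field K] [AddCommGroup V] [Module K V] {n : ℕ}

/-- The right action of `σ` on tensors, permuting the tensor positions:
`v_1 ⊗ ⋯ ⊗ v_n` goes to `v_{σ 1} ⊗ ⋯ ⊗ v_{σ n}`. -/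
noncomputable def permTensor (σ : Perm (Fin n)) :
    (⨂[K] _ : Fin n, V) →ₗ[K] (⨂[K] _ : Fin n, V) :=
  (PiTensorProduct.reindex K (fun _ : Fin n => V) σ.symm).toLinearMap

/-- The right action of the group algebra on tensors, the linear extension of `permTensor`. -/
noncomputable def tensorAct (x : MonoidAlgebra K (Perm (Fin n))) :
    (⨂[K] _ : Fin n, V) →ₗ[K] (⨂[K] _ : Fin n, V) :=
  ∑ σ : Perm (Fin n), x.coeff σ • permTensor K V σ

/-- The endomorphism `T_lam` of the space of tensors,
`(χ^lam(1) / n!) ∑_σ χ^lam(σ) σ`. -/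
noncomputable def charSymmetrizer (lam : n.Partition) :
    (⨂[K] _ : Fin n, V) →ₗ[K] (⨂[K] _ : Fin n, V) :=
  (irrChar K lam 1 / (n.factorial : K)) •
    ∑ σ : Perm (Fin n), irrChar K lam σ • permTensor K V σ

end

end YoungSymm

namespace YoungSymm

open Equiv Finset

/-! By linearity it is enough to compare kernels. Put `z = conjSum (youngSymm K T)`, the sum of all
conjugates of `c_T`, that is, the sum of `c_{σT}` over all `σ`. It is central, and by `mul_irrChar`
it equals `χ^lam` up to a nonzero scalar, so `T_lam` acts as a nonzero multiple of `z`
(`exists_charSymmetrizer_eq`). A tensor killed by every `c_T` is therefore killed by `T_lam`.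
Conversely, `z c_T = β c_T` with `β ≠ 0` (`exists_conjSum_youngSymm_mul`); the action is on the
right, so a tensor killed by `z` is killed by `c_T`.

Scalars arise because `b_T x a_T` is always a multiple of `c_T`
(`exists_colAntisymm_mul_mul_rowSymm`). They are nonzero because `c_T` has coefficient `1` at the
identity: this gives a nonzero trace for `c_T² ≠ 0`, and a nonzero sum of integer squares for `β ≠
0`. -/

/-! ### Counting in Young diagrams. -/

theorem card_cells_ofRowLens (w : List ℕ) (hw : w.SortedGE) :
    (YoungDiagram.ofRowLens w hw).cells.card = w.sum := by
  change (YoungDiagram.cellsOfRowLens w).card = w.sum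
  clear hw
  induction w with
  | nil => simp [YoungDiagram.cellsOfRowLens]
  | cons a w ih =>
    rw [YoungDiagram.cellsOfRowLens, card_union_of_disjoint, card_map, ih]
    · simp
    · rw [disjoint_left]
      simp +contextual

theorem nonempty_tableau {n : ℕ} (lam : n.Partition) : Nonempty (Tableau lam) := by
  have h : (diagram lam).cells.card = n := by
    rw [diagram, card_cells_ofRowLens, ← Multiset.sum_coe, Multiset.sort_eq, lam.parts_sum]
  exact ⟨⟨Fintype.equivOfCardEq (by simpa using h)⟩⟩

/-- If no two numbers are both in the same row of one filling `S` and in the same column of another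
filling `T`, then the row in `S` and the column in `T` of a number always meet in the diagram. -/
theorem mk_row_col_mem {ι : Type*} [Fintype ι] [DecidableEq ι] (μ : YoungDiagram)
    (S T : {c : ℕ × ℕ // c ∈ μ.cells} ≃ ι)
    (hinj : ∀ i j, (S.symm i).1.1 = (S.symm j).1.1 → (T.symm i).1.2 = (T.symm j).1.2 → i = j)
    (i : ι) : ((S.symm i).1.1, (T.symm i).1.2) ∈ μ.cells := by
  set k := μ.colLen (T.symm i).1.2 with hk
  have hT : ∀ l, (T.symm l).1.1 < μ.colLen (T.symm l).1.2 := fun l =>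
    YoungDiagram.mem_iff_lt_colLen.1 (YoungDiagram.mem_cells _ |>.1 (T.symm l).2)
  rw [YoungDiagram.mem_cells, YoungDiagram.mem_iff_lt_colLen, ← hk]
  by_contra! hlt
  -- Both sides count the boxes in the first `k` rows. Sorted by `T`-column, column `j` contributes
  -- at most `min k (μ.colLen j)` on the left, by `hinj`, and exactly that on the right. In the
  -- column of `i` the left side is strictly smaller, since it misses `i`.
  have key : #{l | (S.symm l).1.1 < k} = #{l | (T.symm l).1.1 < k} :=
    card_equiv (S.symm.trans T) (by simp)
  have maps : ∀ (p : ι → Prop) [DecidablePred p], Set.MapsTo (fun l => (T.symm l).1.2)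
      (({l | p l} : Finset ι) : Set ι) (univ.image fun l => (T.symm l).1.2 : Finset ℕ) :=
    fun p _ l _ => by simp
  rw [card_eq_sum_card_fiberwise (maps _), card_eq_sum_card_fiberwise (maps _)] at key
  simp only [filter_filter] at key
  refine absurd key (ne_of_lt (sum_lt_sum (fun j _ => ?_) ⟨(T.symm i).1.2, by simp, ?_⟩))
  · rcases le_or_gt (μ.colLen j) k with hj | hj
    · refine card_le_card fun l => ?_
      simp only [mem_filter, mem_univ, true_and]
      rintro ⟨-, rfl⟩
      exact ⟨(hT l).trans_le hj, rfl⟩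
    · refine le_trans (b := k) ?_ ?_
      · rw [← card_range k]
        refine card_le_card_of_injOn (fun l => (S.symm l).1.1) (fun l hl => ?_) ?_
        · simp only [coe_filter, mem_univ, true_and, Set.mem_ofPred_eq] at hl
          simpa using hl.1
        · intro l hl m hm h
          simp only [coe_filter, mem_univ, true_and, Set.mem_ofPred_eq] at hl hm
          exact hinj l m h (hl.2.trans hm.2.symm)
      · have hmem : ∀ r, r < k → (r, j) ∈ μ.cells := fun r hr => by
          rw [YoungDiagram.mem_cells, YoungDiagram.mem_iff_lt_colLen]
          exact hr.trans hj
        rw [← Fintype.card_fin k, ← card_univ]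
        refine card_le_card_of_injOn (fun r : Fin k => T ⟨(r, j), hmem r r.2⟩) (fun r _ => ?_) ?_
        · simp
        · intro r _ s _ h
          simpa [Fin.ext_iff] using h
  · refine card_lt_card (Finset.ssubset_iff_subset_ne.2 ⟨fun l => ?_, fun h => ?_⟩)
    · simp only [mem_filter, mem_univ, true_and]
      rintro ⟨-, h⟩
      exact ⟨by rw [hk, ← h]; exact hT l, h⟩
    · have : i ∈ ({l | (T.symm l).1.1 < k ∧ (T.symm l).1.2 = (T.symm i).1.2} : Finset ι) := by
        simpa using hT i
      rw [← h] at this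
      simp only [mem_filter, mem_univ, true_and] at this
      exact absurd this.1 (not_lt.2 hlt)

/-! ### Row and column groups of a tableau. -/

section

variable {n : ℕ} {lam : n.Partition} {T : Tableau lam}

theorem mem_rowGroup {σ : Perm (Fin n)} : σ ∈ T.rowGroup ↔ ∀ i, T.rowOf (σ i) = T.rowOf i :=
  Iff.rfl

theorem mem_colGroup {σ : Perm (Fin n)} : σ ∈ T.colGroup ↔ ∀ i, T.colOf (σ i) = T.colOf i :=
  Iff.rfl

theorem Tableau.eq_of_rowOf_eq_of_colOf_eq {i j : Fin n} (hr : T.rowOf i = T.rowOf j)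
    (hc : T.colOf i = T.colOf j) : i = j :=
  T.entry.symm.injective (Subtype.ext (Prod.ext hr hc))

theorem eq_one_of_mem_rowGroup_of_mem_colGroup {σ : Perm (Fin n)} (hr : σ ∈ T.rowGroup)
    (hc : σ ∈ T.colGroup) : σ = 1 :=
  Equiv.ext fun i => Tableau.eq_of_rowOf_eq_of_colOf_eq (hr i) (hc i)

theorem swap_mem_rowGroup {i j : Fin n} (h : T.rowOf i = T.rowOf j) : swap i j ∈ T.rowGroup := by
  intro l
  rw [swap_apply_def]
  split_ifs with h1 h2 <;> simp_all

theorem swap_mem_colGroup {i j : Fin n} (h : T.colOf i = T.colOf j) : swap i j ∈ T.colGroup := by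
  intro l
  rw [swap_apply_def]
  split_ifs with h1 h2 <;> simp_all

/-- Either `g` is a product of a column permutation and a row permutation of `T`, or some two
numbers in the same column of `T` are in the same row of `g • T`. -/
theorem exists_mul_eq_or_exists_ne (T : Tableau lam) (g : Perm (Fin n)) :
    (∃ q ∈ T.colGroup, ∃ p ∈ T.rowGroup, q * p = g) ∨
      ∃ i j, i ≠ j ∧ T.colOf i = T.colOf j ∧ T.rowOf (g⁻¹ i) = T.rowOf (g⁻¹ j) := by
  rw [or_iff_not_imp_right]
  intro h
  have hinj : ∀ i j, T.rowOf (g⁻¹ i) = T.rowOf (g⁻¹ j) → T.colOf i = T.colOf j → i = j := by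
    intro i j hr hc
    by_contra hij
    exact h ⟨i, j, hij, hc, hr⟩
  have hmem := mk_row_col_mem _ (g • T).entry T.entry hinj
  -- `f` moves `i` inside its column of `T` to the row that `i` has in `g • T`. It is thus a column
  -- permutation `q` with `q * g` in the row group.
  let f : Fin n → Fin n := fun i => T.entry ⟨_, hmem i⟩
  have hr : ∀ i, T.rowOf (f i) = T.rowOf (g⁻¹ i) := fun i => by
    simp only [f, Tableau.rowOf, symm_apply_apply]; rfl
  have hc : ∀ i, T.colOf (f i) = T.colOf i := fun i => by
    simp only [f, Tableau.colOf, symm_apply_apply]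
  have hf : Function.Injective f := fun i j hij => by
    refine hinj i j ?_ ?_
    · rw [← hr, hij, hr]
    · rw [← hc, hij, hc]
  let q : Perm (Fin n) := .ofBijective f (Finite.injective_iff_bijective.1 hf)
  refine ⟨q⁻¹, inv_mem (show q ∈ T.colGroup from hc), q * g, fun i => ?_, by group⟩
  simpa [q] using hr (g i)

end

/-! ### Class sums and traces in a group algebra. -/

section

variable {G K : Type*} [Group G] [Fintype G] [Field K]

theorem coeff_mul_eq_sum (x y : MonoidAlgebra K G) (g : G) :
    (x * y).coeff g = ∑ h, x.coeff h * y.coeff (h⁻¹ * g) := by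
  classical
  rw [MonoidAlgebra.coeff_mul_antidiag x y g (univ.image fun h => (h, h⁻¹ * g))]
  · rw [sum_image]
    intro a _ b _ h
    exact congrArg Prod.fst h
  · rintro ⟨a, b⟩
    simp only [mem_image, mem_univ, true_and, Prod.mk.injEq]
    exact ⟨by rintro ⟨h, rfl, rfl⟩; simp, fun h => ⟨a, rfl, by simp [← h]⟩⟩

theorem eq_sum_coeff_smul_single (x : MonoidAlgebra K G) :
    x = ∑ g, x.coeff g • MonoidAlgebra.single g (1 : K) := by
  classical
  ext g
  simp

theorem coeff_mul_mem (R : Subring K) {x y : MonoidAlgebra K G} (hx : ∀ g, x.coeff g ∈ R)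
    (hy : ∀ g, y.coeff g ∈ R) (g : G) : (x * y).coeff g ∈ R := by
  rw [coeff_mul_eq_sum]
  exact sum_mem fun h _ => mul_mem (hx _) (hy _)

/-- The sum of the conjugates of an element of the group algebra. -/
noncomputable def conjSum (x : MonoidAlgebra K G) : MonoidAlgebra K G :=
  ∑ g : G, MonoidAlgebra.single g 1 * x * MonoidAlgebra.single g⁻¹ 1

omit [Fintype G] in
theorem coeff_conj (x : MonoidAlgebra K G) (g h : G) :
    (MonoidAlgebra.single g 1 * x * MonoidAlgebra.single g⁻¹ 1).coeff h =
      x.coeff (g⁻¹ * h * g) := by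
  simp [mul_assoc]

theorem coeff_conjSum (x : MonoidAlgebra K G) (h : G) :
    (conjSum x).coeff h = ∑ g, x.coeff (g⁻¹ * h * g) := by
  simp only [conjSum, MonoidAlgebra.coeff_sum, Finsupp.finsetSum_apply, coeff_conj]

theorem coeff_conjSum_one (x : MonoidAlgebra K G) :
    (conjSum x).coeff 1 = Fintype.card G * x.coeff 1 := by
  simp [coeff_conjSum]

theorem coeff_conjSum_conj (x : MonoidAlgebra K G) (g h : G) :
    (conjSum x).coeff (g * h * g⁻¹) = (conjSum x).coeff h := by
  rw [coeff_conjSum, coeff_conjSum]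
  refine sum_equiv (Equiv.mulLeft g⁻¹) (by simp) fun k _ => ?_
  simp [mul_assoc]

theorem single_mul_conjSum (x : MonoidAlgebra K G) (g : G) :
    MonoidAlgebra.single g 1 * conjSum x = conjSum x * MonoidAlgebra.single g 1 := by
  simp only [conjSum, mul_sum, sum_mul]
  refine sum_equiv (Equiv.mulLeft g) (by simp) fun k _ => ?_
  rw [Equiv.coe_mulLeft, mul_assoc (_ * x), MonoidAlgebra.single_mul_single, ← mul_assoc,
    ← mul_assoc, MonoidAlgebra.single_mul_single]
  simp

/-- The trace of the endomorphism `y ↦ g y x` of the group algebra. -/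
theorem trace_mulLeft_single_mulRight (x : MonoidAlgebra K G) (g : G) :
    LinearMap.trace K (MonoidAlgebra K G)
      (LinearMap.mulLeft K (MonoidAlgebra.single g 1) ∘ₗ LinearMap.mulRight K x) =
      (conjSum x).coeff g⁻¹ := by
  classical
  rw [LinearMap.trace_eq_matrix_trace K (MonoidAlgebra.basis G K), Matrix.trace, coeff_conjSum]
  refine sum_congr rfl fun h _ => ?_
  simp only [Matrix.diag_apply, LinearMap.toMatrix_apply, MonoidAlgebra.basis_apply,
    LinearMap.comp_apply, LinearMap.mulLeft_apply, LinearMap.mulRight_apply]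
  change (MonoidAlgebra.single g 1 * (MonoidAlgebra.single h 1 * x)).coeff h = _
  simp [mul_assoc]

end

/-! ### Young symmetrizers. -/

section

variable {n : ℕ} {lam : n.Partition} {T : Tableau lam} {K : Type*} [Field K]

open Classical in
theorem coeff_rowSymm (σ : Perm (Fin n)) :
    (rowSymm K T).coeff σ = if σ ∈ T.rowGroup then 1 else 0 := by
  simp [rowSymm, Finsupp.single_apply]

open Classical in
theorem coeff_colAntisymm (σ : Perm (Fin n)) :
    (colAntisymm K T).coeff σ = if σ ∈ T.colGroup then ((Perm.sign σ : ℤ) : K) else 0 := by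
  simp [colAntisymm, Finsupp.single_apply]

theorem single_mul_rowSymm {p : Perm (Fin n)} (hp : p ∈ T.rowGroup) :
    MonoidAlgebra.single p 1 * rowSymm K T = rowSymm K T := by
  classical
  ext σ
  simp [coeff_rowSymm, Subgroup.mul_mem_cancel_left, hp]

theorem colAntisymm_mul_single {q : Perm (Fin n)} (hq : q ∈ T.colGroup) :
    colAntisymm K T * MonoidAlgebra.single q 1 = ((Perm.sign q : ℤ) : K) • colAntisymm K T := by
  classical
  ext σ
  simp [coeff_colAntisymm, Subgroup.mul_mem_cancel_right, hq, mul_comm]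

/-- The row and column groups meet trivially, so only the pair `(1, 1)` contributes. -/
theorem coeff_youngSymm_one : (youngSymm K T).coeff 1 = 1 := by
  classical
  rw [youngSymm, coeff_mul_eq_sum, sum_eq_single 1]
  · simp [coeff_colAntisymm, coeff_rowSymm, one_mem]
  · intro σ _ h
    rw [coeff_colAntisymm, coeff_rowSymm]
    split_ifs with hc hr
    · rw [mul_one, inv_mem_iff] at hr
      exact absurd (eq_one_of_mem_rowGroup_of_mem_colGroup hr hc) h
    all_goals simp
  · simp

theorem coeff_youngSymm_mem_range_intCast (σ : Perm (Fin n)) :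
    (youngSymm K T).coeff σ ∈ (Int.castRingHom K).range := by
  classical
  refine coeff_mul_mem _ (fun g => ?_) (fun g => ?_) σ
  · rw [coeff_colAntisymm]
    split_ifs
    exacts [⟨_, rfl⟩, zero_mem _]
  · rw [coeff_rowSymm]
    split_ifs
    exacts [one_mem _, zero_mem _]

theorem conj_rowSymm (σ : Perm (Fin n)) :
    MonoidAlgebra.single σ 1 * rowSymm K T * MonoidAlgebra.single σ⁻¹ 1 = rowSymm K (σ • T) := by
  classical
  ext τ
  rw [coeff_conj, coeff_rowSymm, coeff_rowSymm]
  congr 1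
  simp only [mem_rowGroup, rowOf_smul, Perm.mul_apply, eq_iff_iff]
  exact ⟨fun h i => by simpa using h (σ⁻¹ i), fun h i => by simpa using h (σ i)⟩

theorem conj_youngSymm (σ : Perm (Fin n)) :
    MonoidAlgebra.single σ 1 * youngSymm K T * MonoidAlgebra.single σ⁻¹ 1 =
      youngSymm K (σ • T) := by
  rw [youngSymm, youngSymm, ← conj_rowSymm, ← mul_assoc, single_mul_colAntisymm]
  simp only [mul_assoc]

theorem conjSum_youngSymm :
    conjSum (youngSymm K T) = ∑ σ : Perm (Fin n), youngSymm K (σ • T) :=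
  sum_congr rfl fun σ _ => conj_youngSymm σ

variable [CharZero K]

/-- If `g = q p`, both factors are absorbed, leaving the sign of `q`. Otherwise a transposition from
the row group passes through `g` to become one from the column group, and the product equals its own
negative. -/
theorem exists_colAntisymm_mul_single_mul_rowSymm (T : Tableau lam) (g : Perm (Fin n)) :
    ∃ k : K, colAntisymm K T * MonoidAlgebra.single g 1 * rowSymm K T = k • youngSymm K T := by
  rcases exists_mul_eq_or_exists_ne T g with ⟨q, hq, p, hp, rfl⟩ | ⟨i, j, hij, hc, hr⟩
  · refine ⟨((Perm.sign q : ℤ) : K), ?_⟩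
    have : MonoidAlgebra.single (q * p) (1 : K) =
        MonoidAlgebra.single q 1 * MonoidAlgebra.single p 1 := by simp
    rw [this, ← mul_assoc, mul_assoc, single_mul_rowSymm hp, colAntisymm_mul_single hq,
      smul_mul_assoc, youngSymm]
  · refine ⟨0, ?_⟩
    have hg : g * swap (g⁻¹ i) (g⁻¹ j) = swap i j * g := by
      rw [mul_swap_eq_swap_mul]
      simp
    have key : colAntisymm K T * MonoidAlgebra.single g 1 * rowSymm K T =
        -(colAntisymm K T * MonoidAlgebra.single g 1 * rowSymm K T) := by
      conv_lhs =>
        rw [← single_mul_rowSymm (swap_mem_rowGroup hr), ← mul_assoc, mul_assoc (colAntisymm K T),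
          MonoidAlgebra.single_mul_single, hg, ← MonoidAlgebra.single_mul_single, ← mul_assoc,
          colAntisymm_mul_single (swap_mem_colGroup hc), Perm.sign_swap hij]
      simp
    have : IsAddTorsionFree (MonoidAlgebra K (Perm (Fin n))) := .of_module_rat _
    rw [zero_smul]
    exact self_eq_neg.1 key

theorem exists_colAntisymm_mul_mul_rowSymm (T : Tableau lam) (x : MonoidAlgebra K (Perm (Fin n))) :
    ∃ k : K, colAntisymm K T * x * rowSymm K T = k • youngSymm K T := by
  choose k hk using exists_colAntisymm_mul_single_mul_rowSymm (K := K) T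
  refine ⟨∑ g, x.coeff g * k g, ?_⟩
  conv_lhs => rw [eq_sum_coeff_smul_single x]
  simp only [mul_sum, sum_mul, mul_smul_comm, smul_mul_assoc, hk, smul_smul, sum_smul]

theorem exists_youngSymm_mul_self (T : Tableau lam) :
    ∃ h : K, h ≠ 0 ∧ youngSymm K T * youngSymm K T = h • youngSymm K T := by
  obtain ⟨h, hh⟩ := exists_colAntisymm_mul_mul_rowSymm (K := K) T (rowSymm K T * colAntisymm K T)
  have hsq : youngSymm K T * youngSymm K T = h • youngSymm K T := by
    rw [← hh, youngSymm]
    simp only [mul_assoc]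
  refine ⟨h, ?_, hsq⟩
  rintro rfl
  rw [zero_smul] at hsq
  -- If `c_T² = 0`, right multiplication by `c_T` has trace `0`; but its trace is `n!` times the
  -- coefficient `1` of `c_T` at the identity.
  have hnil : IsNilpotent (LinearMap.mulRight K (youngSymm K T)) :=
    ⟨2, LinearMap.ext fun x => by simp [pow_two, mul_assoc, hsq]⟩
  have htr := trace_mulLeft_single_mulRight (youngSymm K T) 1
  rw [inv_one, coeff_conjSum_one, coeff_youngSymm_one, ← MonoidAlgebra.one_def,
    LinearMap.mulLeft_one, LinearMap.id_comp,
    (LinearMap.isNilpotent_trace_of_isNilpotent hnil).eq_zero] at htr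
  simp [Fintype.card_perm, eq_comm, Nat.factorial_ne_zero] at htr

theorem exists_conjSum_youngSymm_mul (T : Tableau lam) :
    ∃ β : K, β ≠ 0 ∧ conjSum (youngSymm K T) * youngSymm K T = β • youngSymm K T := by
  obtain ⟨h, hh, hsq⟩ := exists_youngSymm_mul_self (K := K) T
  set z := conjSum (youngSymm K T) with hz
  obtain ⟨k, hk⟩ := exists_colAntisymm_mul_mul_rowSymm (K := K) T
    (rowSymm K T * z * colAntisymm K T)
  have hcomm : ∀ x, x * z = z * x := fun x => by
    conv_lhs => rw [eq_sum_coeff_smul_single x]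
    conv_rhs => rw [eq_sum_coeff_smul_single x]
    simp only [sum_mul, mul_sum, smul_mul_assoc, mul_smul_comm, hz, single_mul_conjSum]
  -- By centrality `h z c_T = z c_T c_T = c_T z c_T = b_T (a_T z b_T) a_T`.
  have hβ : z * youngSymm K T = (h⁻¹ * k) • youngSymm K T := by
    rw [mul_smul, ← hk, eq_inv_smul_iff₀ hh, ← mul_smul_comm, ← hsq, ← mul_assoc, ← hcomm,
      youngSymm]
    simp only [mul_assoc]
  refine ⟨h⁻¹ * k, fun h0 => ?_, hβ⟩
  -- If `z` kills `c_T`, being central it kills every conjugate of `c_T`, hence their sum `z`.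
  have hzz : z * z = 0 := by
    conv_lhs => enter [2]; rw [hz, conjSum]
    rw [mul_sum]
    refine sum_eq_zero fun g _ => ?_
    rw [← mul_assoc, ← mul_assoc, ← hcomm, mul_assoc (MonoidAlgebra.single g 1), hβ, h0]
    simp
  have hint : ∀ σ, ∃ m : ℤ, (m : K) = z.coeff σ := fun σ => by
    rw [hz, coeff_conjSum]
    exact sum_mem (S := (Int.castRingHom K).range)
      fun g _ => coeff_youngSymm_mem_range_intCast _
  choose m hm using hint
  have hinv : ∀ σ, z.coeff σ⁻¹ = z.coeff σ := fun σ => by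
    obtain ⟨g, hg⟩ := isConj_iff.1 (Perm.isConj_iff_cycleType_eq.2 (Perm.cycleType_inv σ))
    rw [← coeff_conjSum_conj _ g, hg]
  -- As `z` takes equal values at `σ` and `σ⁻¹`, the coefficient of `z * z` at `1` is a sum of
  -- squares of integers. Integrality matters: in a general `K` such a sum can vanish nontrivially.
  have hsum : ∑ σ, m σ * m σ = 0 := by
    have := coeff_mul_eq_sum z z 1
    simp only [hzz, mul_one, hinv, ← hm, MonoidAlgebra.coeff_zero, Finsupp.zero_apply] at this
    exact_mod_cast this.symm
  rw [sum_eq_zero_iff_of_nonneg fun σ _ => mul_self_nonneg _] at hsum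
  have h1 := hm 1
  rw [mul_self_eq_zero.1 (hsum 1 (mem_univ _)), hz, coeff_conjSum_one, coeff_youngSymm_one] at h1
  simp [Fintype.card_perm, eq_comm, Nat.factorial_ne_zero] at h1

end

/-! ### The character of the Specht module. -/

section

variable {n : ℕ} {lam : n.Partition} {K : Type*} [Field K]

instance : Finite (Tableau lam) :=
  Finite.of_injective Tableau.entry fun _ _ h => Tableau.ext h

instance : Finite (Tabloid lam) := inferInstanceAs (Finite (Quotient (rowSetoid lam)))

theorem exists_smul_tableau_eq (T S : Tableau lam) : ∃ g : Perm (Fin n), g • T = S :=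
  ⟨T.entry.symm.trans S.entry, Tableau.ext (Equiv.ext fun c => by
    change S.entry (T.entry.symm (T.entry c)) = _
    simp)⟩

theorem smul_tabloid_eq_iff {T : Tableau lam} {σ τ : Perm (Fin n)} :
    σ • T.tabloid = τ • T.tabloid ↔ τ⁻¹ * σ ∈ T.rowGroup := by
  refine (Quotient.eq (r := rowSetoid lam)).trans ?_
  change (∀ i, T.rowOf (σ⁻¹ i) = T.rowOf (τ⁻¹ i)) ↔ ∀ i, T.rowOf ((τ⁻¹ * σ) i) = T.rowOf i
  exact ⟨fun h i => by simpa using (h (σ i)).symm, fun h i => by simpa using (h (σ⁻¹ i)).symm⟩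

/-- The map from the span of the tabloids to the group algebra that sends a tabloid to the sum of
the permutations that carry `T` to it. -/
noncomputable def tabloidToAlgebra (K : Type*) [Field K] (T : Tableau lam) :
    MonoidAlgebra K (Tabloid lam) →ₗ[K] MonoidAlgebra K (Perm (Fin n)) :=
  open Classical in
  (MonoidAlgebra.basis (Tabloid lam) K).constr K fun t =>
    ∑ σ : Perm (Fin n) with σ • T.tabloid = t, MonoidAlgebra.single σ 1

theorem tabloidToAlgebra_asAlgebraHom (T : Tableau lam) (x : MonoidAlgebra K (Perm (Fin n))) :
    tabloidToAlgebra K T ((tabloidRep K lam).asAlgebraHom x (MonoidAlgebra.single T.tabloid 1)) =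
      x * rowSymm K T := by
  classical
  rw [eq_sum_coeff_smul_single x]
  simp only [map_sum, map_smul, LinearMap.sum_apply, LinearMap.smul_apply, sum_mul, smul_mul_assoc,
    Representation.asAlgebraHom_single_one, tabloidRep_single]
  refine sum_congr rfl fun g _ => congrArg _ ?_
  rw [← MonoidAlgebra.basis_apply, tabloidToAlgebra, Module.Basis.constr_basis, rowSymm, mul_sum]
  refine sum_equiv (Equiv.mulLeft g⁻¹) (fun σ => ?_) fun σ _ => ?_
  · simp [smul_tabloid_eq_iff]
  · simp

theorem asAlgebraHom_polytabloid_mem (T : Tableau lam) (x : MonoidAlgebra K (Perm (Fin n))) :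
    (tabloidRep K lam).asAlgebraHom x (polytabloid K T) ∈ (specht K lam).toSubmodule := by
  rw [eq_sum_coeff_smul_single x]
  simp only [map_sum, map_smul, LinearMap.sum_apply, LinearMap.smul_apply,
    Representation.asAlgebraHom_single_one, tabloidRep_polytabloid]
  exact sum_mem fun g _ => Submodule.smul_mem _ _ (Submodule.subset_span ⟨_, rfl⟩)

/-- The map from the group algebra to the Specht module given by the action on the polytabloid
of `T`. -/
noncomputable def algebraToSpecht (K : Type*) [Field K] (T : Tableau lam) :
    MonoidAlgebra K (Perm (Fin n)) →ₗ[K] (specht K lam).toSubmodule :=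
  ((tabloidRep K lam).asAlgebraHom.toLinearMap.flip (polytabloid K T)).codRestrict _
    (asAlgebraHom_polytabloid_mem T)

theorem coe_algebraToSpecht (T : Tableau lam) (x : MonoidAlgebra K (Perm (Fin n))) :
    (algebraToSpecht K T x : MonoidAlgebra K (Tabloid lam)) =
      (tabloidRep K lam).asAlgebraHom x (polytabloid K T) := rfl

theorem tabloidToAlgebra_algebraToSpecht (T : Tableau lam)
    (x : MonoidAlgebra K (Perm (Fin n))) :
    tabloidToAlgebra K T (algebraToSpecht K T x) = x * youngSymm K T := by
  rw [coe_algebraToSpecht, polytabloid, ← Module.End.mul_apply, ← map_mul,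
    tabloidToAlgebra_asAlgebraHom, youngSymm, mul_assoc]

theorem asAlgebraHom_rowSymm_tabloid (T : Tableau lam) :
    (tabloidRep K lam).asAlgebraHom (rowSymm K T) (MonoidAlgebra.single T.tabloid 1) =
      (Nat.card T.rowGroup : K) • MonoidAlgebra.single T.tabloid 1 := by
  classical
  have : ∀ σ ∈ univ.filter (· ∈ T.rowGroup),
      tabloidRep K lam σ (MonoidAlgebra.single T.tabloid 1) =
        MonoidAlgebra.single T.tabloid 1 := by
    intro σ hσ
    rw [tabloidRep_single]
    congr 1
    simpa using smul_tabloid_eq_iff (σ := σ) (τ := 1) (T := T) |>.2 (by simpa using hσ)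
  simp only [rowSymm, map_sum, LinearMap.sum_apply, Representation.asAlgebraHom_single_one]
  rw [sum_congr rfl this, sum_const, Nat.card_eq_fintype_card, Fintype.card_subtype,
    Nat.cast_smul_eq_nsmul]

theorem algebraToSpecht_surjective (T : Tableau lam) :
    Function.Surjective (algebraToSpecht K T) := by
  have hle : (specht K lam).toSubmodule ≤
      (algebraToSpecht K T).range.map (specht K lam).toSubmodule.subtype := by
    refine Submodule.span_le.2 ?_
    rintro _ ⟨S, rfl⟩
    obtain ⟨g, rfl⟩ := exists_smul_tableau_eq T S
    exact ⟨_, ⟨MonoidAlgebra.single g 1, rfl⟩, by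
      simp [coe_algebraToSpecht, tabloidRep_polytabloid]⟩
  intro y
  obtain ⟨_, ⟨x, rfl⟩, hx⟩ := hle y.2
  exact ⟨x, Subtype.ext hx⟩

variable [CharZero K]

/-- Since `a_T` scales the tabloid of `T` by the order of the row group, `c_T` sends it to that
multiple of the polytabloid. Apply `hsq` to the tabloid and cancel the order. -/
theorem asAlgebraHom_youngSymm_polytabloid {T : Tableau lam} {h : K}
    (hsq : youngSymm K T * youngSymm K T = h • youngSymm K T) :
    (tabloidRep K lam).asAlgebraHom (youngSymm K T) (polytabloid K T) =
      h • polytabloid K T := by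
  have hcard : (Nat.card T.rowGroup : K) ≠ 0 := Nat.cast_ne_zero.2 Nat.card_pos.ne'
  have hy : (tabloidRep K lam).asAlgebraHom (youngSymm K T)
      (MonoidAlgebra.single T.tabloid 1) = (Nat.card T.rowGroup : K) • polytabloid K T := by
    rw [youngSymm, map_mul, Module.End.mul_apply, asAlgebraHom_rowSymm_tabloid, map_smul,
      polytabloid]
  have := congrArg (fun x => (tabloidRep K lam).asAlgebraHom x
    (MonoidAlgebra.single T.tabloid 1)) hsq
  simp only [map_mul, Module.End.mul_apply, hy, map_smul, LinearMap.smul_apply] at this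
  rw [smul_comm] at this
  exact smul_right_injective _ hcard this

/-- The maps `f` and `j` between the group algebra and the Specht module satisfy `f j = h` and `j f
= ` right multiplication by `c_T`. Cyclicity of the trace turns `h` times the character at `σ⁻¹`
into the trace of `y ↦ σ⁻¹ y c_T`. -/
theorem mul_irrChar {T : Tableau lam} {h : K}
    (hsq : youngSymm K T * youngSymm K T = h • youngSymm K T) (σ : Perm (Fin n)) :
    h * irrChar K lam σ = (conjSum (youngSymm K T)).coeff σ := by
  have hconj : irrChar K lam σ⁻¹ = irrChar K lam σ := by
    obtain ⟨g, hg⟩ := isConj_iff.1 (Perm.isConj_iff_cycleType_eq.2 (Perm.cycleType_inv σ))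
    rw [irrChar, irrChar, ← (specht K lam).toRepresentation.char_conj _ g, hg]
  set f := algebraToSpecht K T with hf
  set j := tabloidToAlgebra K T ∘ₗ (specht K lam).toSubmodule.subtype with hj
  have hjf : j ∘ₗ f = LinearMap.mulRight K (youngSymm K T) :=
    LinearMap.ext fun x => tabloidToAlgebra_algebraToSpecht T x
  have hfj : f ∘ₗ j = h • LinearMap.id := by
    refine LinearMap.ext fun y => ?_
    obtain ⟨x, rfl⟩ := algebraToSpecht_surjective T y
    change f ((j ∘ₗ f) x) = h • f x
    rw [hjf]
    refine Subtype.ext ?_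
    rw [LinearMap.mulRight_apply, Submodule.coe_smul, hf, coe_algebraToSpecht, coe_algebraToSpecht,
      map_mul, Module.End.mul_apply, asAlgebraHom_youngSymm_polytabloid hsq, map_smul]
  have hρ : ∀ g, (specht K lam).toRepresentation g ∘ₗ f =
      f ∘ₗ LinearMap.mulLeft K (MonoidAlgebra.single g 1) := fun g =>
    LinearMap.ext fun x => Subtype.ext (by
      change tabloidRep K lam g (f x : MonoidAlgebra K (Tabloid lam)) = _
      rw [LinearMap.comp_apply, hf, coe_algebraToSpecht, coe_algebraToSpecht]
      simp)
  rw [← hconj, irrChar, Representation.character, ← smul_eq_mul, ← map_smul]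
  have : h • (specht K lam).toRepresentation σ⁻¹ =
      f ∘ₗ LinearMap.mulLeft K (MonoidAlgebra.single σ⁻¹ 1) ∘ₗ j := by
    rw [← LinearMap.comp_assoc, ← hρ, LinearMap.comp_assoc, hfj]
    ext
    simp
  rw [this, LinearMap.trace_comp_comm', LinearMap.comp_assoc, hjf,
    trace_mulLeft_single_mulRight, inv_inv]

end

/-! ### The right action on tensors and the comparison of kernels. -/

section

variable {K V : Type*} [Field K] [AddCommGroup V] [Module K V] {n : ℕ}

theorem permTensor_tprod (σ : Perm (Fin n)) (v : Fin n → V) :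
    permTensor K V σ (PiTensorProduct.tprod K v) = PiTensorProduct.tprod K (v ∘ σ) := by
  rw [permTensor]
  erw [PiTensorProduct.reindex_tprod]
  rfl

theorem permTensor_mul (σ τ : Perm (Fin n)) :
    permTensor K V (σ * τ) = permTensor K V τ ∘ₗ permTensor K V σ := by
  ext v
  simp [permTensor_tprod, Function.comp_assoc]

theorem tensorAct_add (x y : MonoidAlgebra K (Perm (Fin n))) :
    tensorAct K V (x + y) = tensorAct K V x + tensorAct K V y := by
  simp [tensorAct, add_smul, sum_add_distrib]

theorem tensorAct_smul (k : K) (x : MonoidAlgebra K (Perm (Fin n))) :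
    tensorAct K V (k • x) = k • tensorAct K V x := by
  simp [tensorAct, mul_smul, smul_sum]

theorem tensorAct_sum {ι : Type*} (s : Finset ι) (x : ι → MonoidAlgebra K (Perm (Fin n))) :
    tensorAct K V (∑ i ∈ s, x i) = ∑ i ∈ s, tensorAct K V (x i) :=
  map_sum (⟨⟨tensorAct K V, by simp [tensorAct]⟩, tensorAct_add⟩ :
    MonoidAlgebra K (Perm (Fin n)) →+ _) x s

theorem tensorAct_single (σ : Perm (Fin n)) :
    tensorAct K V (MonoidAlgebra.single σ 1) = permTensor K V σ := by
  classical
  simp [tensorAct, Finsupp.single_apply]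

theorem tensorAct_mul (x y : MonoidAlgebra K (Perm (Fin n))) :
    tensorAct K V (x * y) = tensorAct K V y ∘ₗ tensorAct K V x := by
  conv_lhs => rw [eq_sum_coeff_smul_single x, eq_sum_coeff_smul_single y]
  refine LinearMap.ext fun w => ?_
  rw [sum_mul_sum]
  simp only [tensorAct_sum, smul_mul_smul_comm, MonoidAlgebra.single_mul_single, mul_one,
    tensorAct_smul, tensorAct_single, permTensor_mul, LinearMap.sum_apply, LinearMap.smul_apply,
    LinearMap.comp_apply]
  simp only [tensorAct, LinearMap.sum_apply, LinearMap.smul_apply, map_sum, map_smul, smul_sum,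
    smul_smul]

variable [CharZero K] {lam : n.Partition}

theorem exists_charSymmetrizer_eq (T : Tableau lam) :
    ∃ k : K, k ≠ 0 ∧
      charSymmetrizer K V lam = k • tensorAct K V (conjSum (youngSymm K T)) := by
  obtain ⟨h, hh, hsq⟩ := exists_youngSymm_mul_self (K := K) T
  have hχ : ∀ σ, irrChar K lam σ = h⁻¹ * (conjSum (youngSymm K T)).coeff σ := fun σ => by
    rw [← mul_irrChar hsq, inv_mul_cancel_left₀ hh]
  have hn : (n.factorial : K) ≠ 0 := Nat.cast_ne_zero.2 n.factorial_ne_zero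
  refine ⟨irrChar K lam 1 / n.factorial * h⁻¹, ?_, ?_⟩
  · rw [hχ, coeff_conjSum_one, coeff_youngSymm_one]
    simp [hh, hn, Fintype.card_perm]
  · simp only [charSymmetrizer, tensorAct, smul_sum, smul_smul, hχ, mul_assoc]

theorem charSymmetrizer_apply_eq_zero_iff (w : ⨂[K] _ : Fin n, V) :
    charSymmetrizer K V lam w = 0 ↔
      ∀ T : Tableau lam, tensorAct K V (youngSymm K T) w = 0 := by
  constructor
  · intro hw T
    obtain ⟨k, hk, hT⟩ := exists_charSymmetrizer_eq (K := K) (V := V) T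
    obtain ⟨β, hβ, hc⟩ := exists_conjSum_youngSymm_mul (K := K) T
    rw [hT, LinearMap.smul_apply, smul_eq_zero_iff_right hk] at hw
    have := congrArg (fun x => tensorAct K V x w) hc
    simp only [tensorAct_mul, LinearMap.comp_apply, hw, map_zero, tensorAct_smul,
      LinearMap.smul_apply] at this
    exact (smul_eq_zero_iff_right hβ).1 this.symm
  · intro hw
    -- One tableau suffices here: its conjugates already sum to a multiple of `T_lam`.
    obtain ⟨T⟩ := nonempty_tableau lam
    obtain ⟨k, -, hT⟩ := exists_charSymmetrizer_eq (K := K) (V := V) T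
    rw [hT, conjSum_youngSymm, tensorAct_sum]
    simp [hw]

end

end YoungSymm

theorem proposition1 {K : Type*} [Field K] [CharZero K]
    {V : Type*} [AddCommGroup V] [Module K V] [FiniteDimensional K V]
    {n : ℕ} (lam : n.Partition) (v u : Fin n → V) :
    YoungSymm.charSymmetrizer K V lam (PiTensorProduct.tprod K v)
        = YoungSymm.charSymmetrizer K V lam (PiTensorProduct.tprod K u) ↔
      ∀ T : YoungSymm.Tableau lam,
        YoungSymm.tensorAct K V (YoungSymm.youngSymm K T) (PiTensorProduct.tprod K v)
          = YoungSymm.tensorAct K V (YoungSymm.youngSymm K T) (PiTensorProduct.tprod K u) := by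
  simpa only [map_sub, sub_eq_zero] using
    YoungSymm.charSymmetrizer_apply_eq_zero_iff (lam := lam)
      (PiTensorProduct.tprod K v - PiTensorProduct.tprod K u)
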